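/- Let $\lambda$ be the real root of $x^3-x^2+1$ and let $z,\bar z$ be its other two complex roots. Put $E=\mathbb{Q}(\lambda,z)$ and $F=\mathbb{Q}(\sqrt{-23})$, as subfields of $\mathbb{C}$. Then $F\subset E$, and there is an automorphism $\sigma$ of $E$ over $F$, with $\sigma^3=1$, such that $$\sigma(\lambda)=z,\qquad \sigma(z)=\bar z,\qquad \sigma(\bar z)=\lambda .$$ Let $B=E\oplus vE\oplus v^2E$ be the cyclic algebra with $v^3=3$ and $e\cdot v=v\cdot\sigma(e)$ for $e\in E$. Then $B$ is a division ring with center $F$ and $[B:F]=9$, and there is a positive anti-involution of the second kind on $B$ over $\mathbb{Q}$; that is, there is a $\mathbb{Q}$-linear map $\phi:B\to B$ such that 1. $\phi(1)=1$, and $\phi(\phi(x))=x$, $\phi(xy)=\phi(y)\phi(x)$ for all $x,y\in B$; 2. $\mathrm{Tr}_{B/\mathbb{Q}}(\phi(x)x)>0$ for all $x\in B\setminus\{0\}$, where $\mathrm{Tr}_{B/\mathbb{Q}}(y)$ is the trace of the $\mathbb{Q}$-linear map $x\mapsto yx$ on $B$; 3. $\phi$ is not the identity on the center of $B$. -/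

import Mathlib

section CyclicAlgebra

variable {F E : Type*} [Field F] [Field E] [Algebra F E]

/-- The cyclic algebra of degree three `E ⊕ v E ⊕ v² E`, with `v ^ 3 = u` and
`e * v = v * σ e` for `e` in `E`, where `σ` is an `F`-automorphism of `E` with `σ ^ 3 = 1` and
`u` is in `F`. The triple `⟨a, b, c⟩` stands for `a + v b + v² c`. -/
@[ext]
structure CubicCyclicAlgebra (σ : E ≃ₐ[F] E) (hσ : σ ^ 3 = 1) (u : F) where
  /-- the coefficient of `1` -/
  c0 : E
  /-- the coefficient of `v` -/
  c1 : E
  /-- the coefficient of `v²` -/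
  c2 : E

namespace CubicCyclicAlgebra

variable {σ : E ≃ₐ[F] E} {hσ : σ ^ 3 = 1} {u : F}

instance : Zero (CubicCyclicAlgebra σ hσ u) := ⟨⟨0, 0, 0⟩⟩
instance : One (CubicCyclicAlgebra σ hσ u) := ⟨⟨1, 0, 0⟩⟩
instance : Add (CubicCyclicAlgebra σ hσ u) :=
  ⟨fun x y => ⟨x.c0 + y.c0, x.c1 + y.c1, x.c2 + y.c2⟩⟩
instance : Neg (CubicCyclicAlgebra σ hσ u) := ⟨fun x => ⟨-x.c0, -x.c1, -x.c2⟩⟩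
instance : Sub (CubicCyclicAlgebra σ hσ u) :=
  ⟨fun x y => ⟨x.c0 - y.c0, x.c1 - y.c1, x.c2 - y.c2⟩⟩

/-- The product determined by
`(v ^ i * a) * (v ^ j * b) = v ^ (i + j) * (σ ^ j) a * b` and `v ^ 3 = u`. -/
instance : Mul (CubicCyclicAlgebra σ hσ u) :=
  ⟨fun x y =>
    ⟨x.c0 * y.c0 + algebraMap F E u * (σ x.c2 * y.c1 + σ (σ x.c1) * y.c2),
      x.c1 * y.c0 + σ x.c0 * y.c1 + algebraMap F E u * (σ (σ x.c2) * y.c2),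
      x.c2 * y.c0 + σ x.c1 * y.c1 + σ (σ x.c0) * y.c2⟩⟩

/-- Scalars act on each coefficient. -/
instance {R : Type*} [SMul R E] : SMul R (CubicCyclicAlgebra σ hσ u) :=
  ⟨fun r x => ⟨r • x.c0, r • x.c1, r • x.c2⟩⟩

@[simp] theorem zero_c0 : (0 : CubicCyclicAlgebra σ hσ u).c0 = 0 := rfl
@[simp] theorem zero_c1 : (0 : CubicCyclicAlgebra σ hσ u).c1 = 0 := rfl
@[simp] theorem zero_c2 : (0 : CubicCyclicAlgebra σ hσ u).c2 = 0 := rfl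
@[simp] theorem one_c0 : (1 : CubicCyclicAlgebra σ hσ u).c0 = 1 := rfl
@[simp] theorem one_c1 : (1 : CubicCyclicAlgebra σ hσ u).c1 = 0 := rfl
@[simp] theorem one_c2 : (1 : CubicCyclicAlgebra σ hσ u).c2 = 0 := rfl

section
variable (x y : CubicCyclicAlgebra σ hσ u)
@[simp] theorem add_c0 : (x + y).c0 = x.c0 + y.c0 := rfl
@[simp] theorem add_c1 : (x + y).c1 = x.c1 + y.c1 := rfl
@[simp] theorem add_c2 : (x + y).c2 = x.c2 + y.c2 := rfl
@[simp] theorem neg_c0 : (-x).c0 = -x.c0 := rfl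
@[simp] theorem neg_c1 : (-x).c1 = -x.c1 := rfl
@[simp] theorem neg_c2 : (-x).c2 = -x.c2 := rfl
@[simp] theorem sub_c0 : (x - y).c0 = x.c0 - y.c0 := rfl
@[simp] theorem sub_c1 : (x - y).c1 = x.c1 - y.c1 := rfl
@[simp] theorem sub_c2 : (x - y).c2 = x.c2 - y.c2 := rfl
@[simp] theorem mul_c0 : (x * y).c0 =
    x.c0 * y.c0 + algebraMap F E u * (σ x.c2 * y.c1 + σ (σ x.c1) * y.c2) := rfl
@[simp] theorem mul_c1 : (x * y).c1 =
    x.c1 * y.c0 + σ x.c0 * y.c1 + algebraMap F E u * (σ (σ x.c2) * y.c2) := rfl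
@[simp] theorem mul_c2 : (x * y).c2 =
    x.c2 * y.c0 + σ x.c1 * y.c1 + σ (σ x.c0) * y.c2 := rfl
@[simp] theorem smul_c0 {R : Type*} [SMul R E] (r : R) : (r • x).c0 = r • x.c0 := rfl
@[simp] theorem smul_c1 {R : Type*} [SMul R E] (r : R) : (r • x).c1 = r • x.c1 := rfl
@[simp] theorem smul_c2 {R : Type*} [SMul R E] (r : R) : (r • x).c2 = r • x.c2 := rfl
end

theorem apply_three {σ : E ≃ₐ[F] E} (hσ : σ ^ 3 = 1) (e : E) : σ (σ (σ e)) = e := by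
  have h := congrArg (fun τ : E ≃ₐ[F] E => τ e) hσ
  simpa [pow_succ] using h

instance : AddCommGroup (CubicCyclicAlgebra σ hσ u) where
  add_assoc x y z := by ext <;> simp [add_assoc]
  zero_add x := by ext <;> simp
  add_zero x := by ext <;> simp
  add_comm x y := by ext <;> simp [add_comm]
  neg_add_cancel x := by ext <;> simp
  sub_eq_add_neg x y := by ext <;> simp [sub_eq_add_neg]
  nsmul n x := n • x
  nsmul_zero x := by ext <;> simp
  nsmul_succ n x := by ext <;> simp [add_mul]
  zsmul n x := n • x
  zsmul_zero' x := by ext <;> simp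
  zsmul_succ' n x := by ext <;> simp [add_mul]
  zsmul_neg' n x := by ext <;> simp [Int.negSucc_eq] <;> ring

instance : Ring (CubicCyclicAlgebra σ hσ u) where
  zero_mul x := by ext <;> simp
  mul_zero x := by ext <;> simp
  one_mul x := by ext <;> simp
  mul_one x := by ext <;> simp
  left_distrib x y z := by ext <;> simp <;> ring
  right_distrib x y z := by ext <;> simp <;> ring
  mul_assoc x y z := by ext <;> simp [apply_three hσ] <;> ring
  neg_add_cancel := neg_add_cancel
  sub_eq_add_neg := sub_eq_add_neg
  zsmul n x := n • x
  zsmul_zero' := SubNegMonoid.zsmul_zero'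
  zsmul_succ' := SubNegMonoid.zsmul_succ'
  zsmul_neg' := SubNegMonoid.zsmul_neg'

/-- The cyclic algebra is an algebra over `F`, and over every commutative ring `R` over which
`F` is an algebra, through `R → F → E ⊆ E ⊕ v E ⊕ v² E`. -/
instance {R : Type*} [CommSemiring R] [Algebra R F] [Algebra R E] [IsScalarTower R F E] :
    Algebra R (CubicCyclicAlgebra σ hσ u) where
  algebraMap :=
    { toFun := fun r => ⟨algebraMap R E r, 0, 0⟩
      map_zero' := by ext <;> simp
      map_one' := by ext <;> simp
      map_add' := fun r s => by ext <;> simp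
      map_mul' := fun r s => by ext <;> simp }
  commutes' r x := by
    have h : σ (algebraMap R E r) = algebraMap R E r := by
      rw [IsScalarTower.algebraMap_apply R F E, AlgEquiv.commutes]
    ext <;> simp [h, mul_comm]
  smul_def' r x := by
    have h : σ (algebraMap R E r) = algebraMap R E r := by
      rw [IsScalarTower.algebraMap_apply R F E, AlgEquiv.commutes]
    ext <;> simp [h, Algebra.smul_def]

end CubicCyclicAlgebra

end CyclicAlgebra

section Involution

variable {B : Type*} [Ring B] [Algebra ℚ B]

/-- A `ℚ`-linear anti-involution of a `ℚ`-algebra. -/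
structure IsAntiInvolution (φ : B →ₗ[ℚ] B) : Prop where
  map_one : φ 1 = 1
  involutive : ∀ x, φ (φ x) = x
  map_mul : ∀ x y, φ (x * y) = φ y * φ x

/-- A positive anti-involution over `ℚ`; the trace over `ℚ` of an element `y` of `B` is that of the
`ℚ`-linear map `x ↦ y * x` on `B`. -/
structure IsPositiveAntiInvolution (φ : B →ₗ[ℚ] B) : Prop extends IsAntiInvolution φ where
  trace_pos : ∀ x, x ≠ 0 → 0 < LinearMap.trace ℚ B (LinearMap.mulLeft ℚ (φ x * x))

/-- `φ` is of the second kind: it is not the identity on the center of `B`. -/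
def IsOfSecondKind (φ : B →ₗ[ℚ] B) : Prop :=
  ∃ x ∈ Subalgebra.center ℚ B, φ x ≠ x

end Involution

/-- The subfield `ℚ(√-23)` of `ℂ`. -/
noncomputable def fieldF : IntermediateField ℚ ℂ :=
  IntermediateField.adjoin ℚ {((Real.sqrt 23 : ℝ) : ℂ) * Complex.I}

/-- The subfield `ℚ(lam, z)` of `ℂ`. -/
noncomputable def fieldE (lam : ℝ) (z : ℂ) : IntermediateField ℚ ℂ :=
  IntermediateField.adjoin ℚ {(lam : ℂ), z}

/-!
At the prime `3` the field `F` splits, since `-23` is a square in `ℚ₃`, and `x³ - x² + 1` is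
irreducible modulo `3`. Hence `E` has a `σ`-invariant valuation, unramified over `ℚ₃`, for which the
valuations of norms are divisible by `3`. The three norms `N(c₀)`, `3 N(c₁)`, `9 N(c₂)` in the
reduced norm of `c₀ + v c₁ + v² c₂` then have distinct valuations, one of them dominates the
reduced norm, which therefore does not vanish, and `B` is a division ring.

The discriminant `-23` is a square in `F`, so `E / F` is cyclic and its generator `σ` rotates the
roots. Complex conjugation `τ` satisfies `τ σ = σ⁻¹ τ` and extends to `B` by `v ↦ v`. In the
splitting `B → M₃(ℂ)` this is the adjoint for an indefinite form. Conjugating by the element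
`t = p + v σ²(p) + v² σ(p)` makes the form definite as soon as `p` is real and large compared with
its conjugate `σ(p)`, which holds for `p = (1 - λ)⁴`.
-/

section Valuation

variable {E Γ₀ : Type*} [Field E] [LinearOrderedCommGroupWithZero Γ₀] (w : Valuation E Γ₀)

theorem add_add_ne_of_valuation_lt {a b c t : E} (hb : w b < w a) (hc : w c < w a)
    (ht : w t ^ 3 ≤ w a * w b * w c) : a + b + c ≠ t := by
  have h_sum : w (a + b + c) = w a := by
    rw [add_assoc, w.map_add_eq_of_lt_left (w.map_add_lt hb hc)]
  have h_lt : w t < w a := by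
    refine lt_of_pow_lt_pow_left₀ 3 zero_le (ht.trans_lt ?_)
    calc w a * w b * w c ≤ w a * w a * w c := by gcongr
      _ < w a * w a * w a := mul_lt_mul_of_pos_left hc (by have := zero_le.trans_lt hb; positivity)
      _ = w a ^ 3 := (pow_three' _).symm
  rintro rfl
  exact h_lt.ne h_sum

theorem add_add_ne_of_valuation_ne {a b c t : E} (h0 : a ≠ 0 ∨ b ≠ 0 ∨ c ≠ 0)
    (hab : w a = w b → b = 0) (hbc : w b = w c → c = 0) (hca : w c = w a → a = 0)
    (ht : w t ^ 3 ≤ w a * w b * w c) : a + b + c ≠ t := by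
  have h_nonneg : ∀ x, 0 ≤ w x := fun _ => zero_le
  have h_zero : ∀ x, w x = 0 ↔ x = 0 := fun _ => map_eq_zero w
  have h_max : (w b < w a ∧ w c < w a) ∨ (w c < w b ∧ w a < w b) ∨ (w a < w c ∧ w b < w c) := by
    grind
  rcases h_max with ⟨h1, h2⟩ | ⟨h1, h2⟩ | ⟨h1, h2⟩
  · exact add_add_ne_of_valuation_lt w h1 h2 ht
  · rw [add_rotate]
    exact add_add_ne_of_valuation_lt w h1 h2 (ht.trans_eq (mul_rotate _ _ _))
  · rw [← add_rotate]
    exact add_add_ne_of_valuation_lt w h1 h2 (ht.trans_eq (mul_rotate _ _ _).symm)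

end Valuation

namespace CubicCyclicAlgebra

variable {F E : Type*} [Field F] [Field E] [Algebra F E]
variable {σ : E ≃ₐ[F] E} {hσ : σ ^ 3 = 1} {u : F}

/-- The adjugate of `x`, i.e. the reduced norm of `x` times the inverse of `x`. -/
def adjugate (x : CubicCyclicAlgebra σ hσ u) : CubicCyclicAlgebra σ hσ u :=
  ⟨σ x.c0 * σ (σ x.c0) - algebraMap F E u * (σ x.c1 * σ (σ x.c2)),
    algebraMap F E u * (x.c2 * σ (σ x.c2)) - x.c1 * σ (σ x.c0),
    x.c1 * σ x.c1 - x.c2 * σ x.c0⟩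

/-- The reduced norm, as an element of `E` that is not a priori fixed by `σ`. -/
def reducedNorm (x : CubicCyclicAlgebra σ hσ u) : E :=
  x.c0 * σ x.c0 * σ (σ x.c0) + algebraMap F E u * (x.c1 * σ x.c1 * σ (σ x.c1)) +
    algebraMap F E u ^ 2 * (x.c2 * σ x.c2 * σ (σ x.c2)) -
    algebraMap F E u * (x.c0 * σ x.c1 * σ (σ x.c2) + σ x.c0 * σ (σ x.c1) * x.c2 +
      σ (σ x.c0) * x.c1 * σ x.c2)

theorem mul_adjugate (x : CubicCyclicAlgebra σ hσ u) : x * x.adjugate = ⟨x.reducedNorm, 0, 0⟩ := by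
  ext <;> simp [adjugate, reducedNorm] <;> ring

theorem adjugate_mul (x : CubicCyclicAlgebra σ hσ u) : x.adjugate * x = ⟨x.reducedNorm, 0, 0⟩ := by
  ext <;> simp [adjugate, reducedNorm, apply_three hσ] <;> ring

theorem isUnit_of_reducedNorm_ne_zero {x : CubicCyclicAlgebra σ hσ u} (hx : x.reducedNorm ≠ 0) :
    IsUnit x := by
  have h_right : x * (x.adjugate * ⟨x.reducedNorm⁻¹, 0, 0⟩) = 1 := by
    rw [← mul_assoc, mul_adjugate]
    ext <;> simp [hx]
  have h_left : (⟨x.reducedNorm⁻¹, 0, 0⟩ * x.adjugate) * x = 1 := by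
    rw [mul_assoc, adjugate_mul]
    ext <;> simp [hx]
  exact isUnit_iff_exists_and_exists.2 ⟨⟨_, h_right⟩, ⟨_, h_left⟩⟩

section Valuation

variable {Γ₀ : Type*} [LinearOrderedCommGroupWithZero Γ₀] (w : Valuation E Γ₀)

theorem valuation_mul_map_mul_map_map (hw : ∀ e, w (σ e) = w e) (e : E) :
    w (e * σ e * σ (σ e)) = w e ^ 3 := by
  simp only [map_mul, hw, pow_three']

theorem valuation_trace_le (hw : ∀ e, w (σ e) = w e) (a b c : E) :
    w (a * σ b * σ (σ c) + σ a * σ (σ b) * c + σ (σ a) * b * σ c) ≤ w a * w b * w c := by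
  refine w.map_add_le (w.map_add_le ?_ ?_) ?_ <;> simp only [map_mul, hw, le_refl]

/-- The three norms occurring in the reduced norm have distinct values, and the trace that is
subtracted has at most their geometric mean as its value. -/
theorem reducedNorm_ne_zero (hw : ∀ e, w (σ e) = w e)
    (hu : ∀ e, w e ^ 3 ≠ w (algebraMap F E u)) {x : CubicCyclicAlgebra σ hσ u} (hx : x ≠ 0) :
    x.reducedNorm ≠ 0 := by
  obtain ⟨a, b, c⟩ := x
  simp only [reducedNorm, sub_ne_zero]
  simp only [ne_eq, CubicCyclicAlgebra.ext_iff, zero_c0, zero_c1, zero_c2] at hx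
  generalize algebraMap F E u = U at *
  have hU : U ≠ 0 := (map_ne_zero w).1 (by simpa [eq_comm] using hu 0)
  have h_eq : ∀ {a b}, w a ^ 3 = w U * w b ^ 3 → b = 0 := by
    intro a b h
    by_contra hb
    exact hu (a / b) (by rw [map_div₀, div_pow, h, mul_div_cancel_right₀]; simp [hb])
  have h_norm := valuation_mul_map_mul_map_map w hw
  have h_norm_b : w (U * (b * σ b * σ (σ b))) = w U * w b ^ 3 := by rw [map_mul, h_norm]
  have h_norm_c : w (U ^ 2 * (c * σ c * σ (σ c))) = w U ^ 2 * w c ^ 3 := by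
    rw [map_mul, map_pow, h_norm]
  have h_trace : w (U * (a * σ b * σ (σ c) + σ a * σ (σ b) * c + σ (σ a) * b * σ c)) ≤
      w U * (w a * w b * w c) := by
    rw [map_mul]
    gcongr
    exact valuation_trace_le w hw a b c
  refine add_add_ne_of_valuation_ne w ?_ ?_ ?_ ?_ ?_
  · contrapose! hx
    simpa [hU] using hx
  · intro h
    rw [h_norm a, h_norm_b] at h
    simp [h_eq h]
  · intro h
    rw [h_norm_b, h_norm_c, pow_two, mul_assoc] at h
    simp [h_eq (mul_left_cancel₀ ((map_ne_zero w).2 hU) h)]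
  · intro h
    rw [h_norm a, h_norm_c] at h
    have : w (U * c) ^ 3 = w U * w a ^ 3 := by
      rw [← h, map_mul]
      field_simp
    simp [h_eq this]
  · grw [h_trace]
    rw [h_norm a, h_norm_b, h_norm_c]
    refine le_of_eq ?_
    field_simp

theorem isUnit_of_ne_zero (hw : ∀ e, w (σ e) = w e)
    (hu : ∀ e, w e ^ 3 ≠ w (algebraMap F E u)) {x : CubicCyclicAlgebra σ hσ u} (hx : x ≠ 0) :
    IsUnit x :=
  isUnit_of_reducedNorm_ne_zero (reducedNorm_ne_zero w hw hu hx)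

end Valuation

/-- The coefficients, as a linear equivalence. -/
def coeffEquiv (R : Type*) [CommSemiring R] [Algebra R F] [Algebra R E] [IsScalarTower R F E] :
    CubicCyclicAlgebra σ hσ u ≃ₗ[R] E × E × E where
  toFun x := (x.c0, x.c1, x.c2)
  invFun p := ⟨p.1, p.2.1, p.2.2⟩
  map_add' _ _ := rfl
  map_smul' _ _ := rfl
  left_inv _ := rfl
  right_inv _ := rfl

theorem finrank_eq [FiniteDimensional F E] :
    Module.finrank F (CubicCyclicAlgebra σ hσ u) = 3 * Module.finrank F E := by
  rw [(coeffEquiv F).finrank_eq, Module.finrank_prod, Module.finrank_prod]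
  ring

end CubicCyclicAlgebra

section FixedField

variable {F E : Type*} [Field F] [Field E] [Algebra F E]

theorem mem_range_algebraMap_of_orderOf_eq_finrank [FiniteDimensional F E] {σ : E ≃ₐ[F] E}
    (h : orderOf σ = Module.finrank F E) {e : E} (he : σ e = e) : e ∈ (algebraMap F E).range := by
  let H := Subgroup.zpowers σ
  have h_card : Module.finrank (IntermediateField.fixedField H) E = Module.finrank F E := by
    rw [IntermediateField.finrank_fixedField_eq_card, Nat.card_zpowers, h]
  have h_bot : IntermediateField.fixedField H = ⊥ := by
    have := Module.finrank_mul_finrank F (IntermediateField.fixedField H) E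
    rw [h_card, Nat.mul_eq_right Module.finrank_pos.ne'] at this
    exact IntermediateField.finrank_eq_one_iff.1 this
  have h_mem : e ∈ IntermediateField.fixedField H := by
    rw [IntermediateField.mem_fixedField_iff]
    intro g hg
    have : H ≤ MulAction.stabilizer (E ≃ₐ[F] E) e := by
      rw [Subgroup.zpowers_le]
      exact he
    exact this hg
  rw [h_bot] at h_mem
  exact IntermediateField.mem_bot.1 h_mem

theorem CubicCyclicAlgebra.isCentral {σ : E ≃ₐ[F] E} {hσ : σ ^ 3 = 1} {u : F} (h_ne : σ ≠ 1)
    (hE : Module.finrank F E = 3) : Algebra.IsCentral F (CubicCyclicAlgebra σ hσ u) := by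
  have : FiniteDimensional F E := .of_finrank_pos (by simp [hE])
  have h_order : orderOf σ = Module.finrank F E := by
    rw [hE]
    exact orderOf_eq_prime hσ h_ne
  obtain ⟨l, hl⟩ : ∃ l, σ l ≠ l := by
    by_contra! h
    exact h_ne (AlgEquiv.ext h)
  have hl' : σ (σ l) ≠ l := fun h => hl (by simpa [h] using apply_three hσ l)
  refine ⟨fun x hx => ?_⟩
  rw [Subalgebra.mem_center_iff] at hx
  have h_comm_l := hx ⟨l, 0, 0⟩
  have h1 : x.c1 = 0 := by
    have : σ l * x.c1 = l * x.c1 := by simpa [mul_comm] using congrArg c1 h_comm_l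
    by_contra h
    exact hl (mul_right_cancel₀ h this)
  have h2 : x.c2 = 0 := by
    have : σ (σ l) * x.c2 = l * x.c2 := by simpa [mul_comm] using congrArg c2 h_comm_l
    by_contra h
    exact hl' (mul_right_cancel₀ h this)
  have h0 : σ x.c0 = x.c0 := by simpa [eq_comm] using congrArg c1 (hx ⟨0, 1, 0⟩)
  obtain ⟨a, ha⟩ := mem_range_algebraMap_of_orderOf_eq_finrank h_order h0
  exact Algebra.mem_bot.2 ⟨a, CubicCyclicAlgebra.ext ha h1.symm h2.symm⟩

end FixedField

/-- The norm form of `ℤ[X] / (X³ - X² + 1)` in the basis `1, X, X²`. For a root `l` of the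
cubic, it computes the norm of `a + b l + c l²` over the base field. -/
def cubicNormForm {R : Type*} [CommRing R] (a b c : R) : R :=
  a ^ 3 + a ^ 2 * b + a ^ 2 * c + 3 * a * b * c + 2 * a * c ^ 2 - b ^ 3 - b ^ 2 * c + c ^ 3

section Padic

theorem map_cubicNormForm {R S : Type*} [CommRing R] [CommRing S] (f : R →+* S) (a b c : R) :
    f (cubicNormForm a b c) = cubicNormForm (f a) (f b) (f c) := by
  simp only [cubicNormForm, map_add, map_sub, map_mul, map_pow, map_ofNat]

theorem cubicNormForm_mul {R : Type*} [CommRing R] (k a b c : R) :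
    cubicNormForm (k * a) (k * b) (k * c) = k ^ 3 * cubicNormForm a b c := by
  simp only [cubicNormForm]
  ring

theorem eq_zero_of_cubicNormForm_zmod_three_eq_zero :
    ∀ a b c : ZMod 3, cubicNormForm a b c = 0 → a = 0 ∧ b = 0 ∧ c = 0 := by
  unfold cubicNormForm
  decide

variable {p : ℕ} [Fact p.Prime]

theorem isUnit_cubicNormForm_padicInt
    (hp : ∀ a b c : ZMod p, cubicNormForm a b c = 0 → a = 0 ∧ b = 0 ∧ c = 0) {a b c : ℤ_[p]}
    (h : IsUnit a ∨ IsUnit b ∨ IsUnit c) : IsUnit (cubicNormForm a b c) := by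
  refine isUnit_of_map_unit PadicInt.toZMod _ ?_
  rw [isUnit_iff_ne_zero, map_cubicNormForm]
  intro h0
  obtain ⟨ha, hb, hc⟩ := hp _ _ _ h0
  rcases h with h | h | h
  · exact (h.map PadicInt.toZMod).ne_zero ha
  · exact (h.map PadicInt.toZMod).ne_zero hb
  · exact (h.map PadicInt.toZMod).ne_zero hc

theorem nnnorm_cubicNormForm_padic
    (hp : ∀ a b c : ZMod p, cubicNormForm a b c = 0 → a = 0 ∧ b = 0 ∧ c = 0) (a b c : ℚ_[p]) :
    ‖cubicNormForm a b c‖₊ = max ‖a‖₊ (max ‖b‖₊ ‖c‖₊) ^ 3 := by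
  obtain ⟨k, hk, h_mem⟩ : ∃ k : ℚ_[p], ‖k‖₊ = max ‖a‖₊ (max ‖b‖₊ ‖c‖₊) ∧
      (k = a ∨ k = b ∨ k = c) := by
    grind
  rw [← hk]
  rcases eq_or_ne k 0 with rfl | hk0
  · have h0 : a = 0 ∧ b = 0 ∧ c = 0 := by simpa [eq_comm] using hk
    simp [h0, cubicNormForm]
  have h_scale : ∀ x : ℚ_[p], ‖x‖₊ ≤ ‖k‖₊ → ∃ y : ℤ_[p], x = k * y := fun x hx => by
    refine ⟨⟨x / k, ?_⟩, (mul_div_cancel₀ x hk0).symm⟩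
    rw [norm_div]
    exact div_le_one_of_le₀ hx (norm_nonneg k)
  obtain ⟨a, rfl⟩ := h_scale a (hk ▸ le_max_left _ _)
  obtain ⟨b, rfl⟩ := h_scale b (hk ▸ le_max_of_le_right (le_max_left _ _))
  obtain ⟨c, rfl⟩ := h_scale c (hk ▸ le_max_of_le_right (le_max_right _ _))
  have h_one : ∀ {y : ℤ_[p]}, k = k * y → IsUnit y := fun {y} h => by
    rw [left_eq_mul₀ hk0] at h
    rw [PadicInt.isUnit_iff, PadicInt.norm_def, h, norm_one]
  have h_unit : IsUnit (cubicNormForm a b c) :=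
    isUnit_cubicNormForm_padicInt hp (h_mem.imp h_one (Or.imp h_one h_one))
  have h_coe : ((cubicNormForm a b c : ℤ_[p]) : ℚ_[p]) = cubicNormForm (a : ℚ_[p]) b c :=
    map_cubicNormForm PadicInt.Coe.ringHom a b c
  have h_norm : ‖cubicNormForm (a : ℚ_[p]) b c‖₊ = 1 := by
    rw [← h_coe]
    exact NNReal.eq (PadicInt.isUnit_iff.1 h_unit)
  rw [cubicNormForm_mul, nnnorm_mul, nnnorm_pow, h_norm, mul_one]

theorem nnnorm_padic_pow_ne_nnnorm_p {n : ℕ} (hn : n ≠ 1) (x : ℚ_[p]) :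
    ‖x‖₊ ^ n ≠ ‖(p : ℚ_[p])‖₊ := by
  intro h
  have hx : x ^ n ≠ 0 := by
    rintro hx
    rw [← nnnorm_pow, hx, nnnorm_zero, eq_comm, nnnorm_eq_zero] at h
    exact Nat.cast_ne_zero.2 (Fact.out : p.Prime).ne_zero h
  have h_val : (p : ℝ) ^ (-(x ^ n).valuation) = (p : ℝ) ^ (-1 : ℤ) := by
    rw [← Padic.norm_eq_zpow_neg_valuation hx, norm_pow, zpow_neg_one, ← Padic.norm_p]
    simpa using congrArg NNReal.toReal h
  have hp : 1 < (p : ℝ) := by exact_mod_cast (Fact.out : p.Prime).one_lt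
  have h_eq : (n : ℤ) * x.valuation = 1 := by
    simpa using zpow_right_injective₀ (zero_lt_one.trans hp) hp.ne' h_val
  exact hn (by simpa using Int.eq_one_or_neg_one_of_mul_eq_one h_eq)

theorem exists_padic_sq_eq_intCast (hp : p ≠ 2) {a n : ℤ} (ha : ¬ (p : ℤ) ∣ a)
    (hn : (p : ℤ) ∣ a ^ 2 - n) : ∃ r : ℚ_[p], r ^ 2 = n := by
  have h_two : ‖((2 * a : ℤ) : ℤ_[p])‖ = 1 := by
    refine le_antisymm (PadicInt.norm_le_one _) (not_lt.1 fun h => ?_)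
    rw [PadicInt.norm_intCast_lt_one_iff, Prime.dvd_mul (Nat.prime_iff_prime_int.1 Fact.out)] at h
    refine h.elim (fun h2 => hp ?_) ha
    exact (Nat.prime_dvd_prime_iff_eq Fact.out Nat.prime_two).1 (by exact_mod_cast h2)
  obtain ⟨r, hr, -⟩ := hensels_lemma (p := p) (F := (Polynomial.X ^ 2 - (n : Polynomial ℤ)))
    (a := (a : ℤ_[p])) (by
      have := PadicInt.norm_intCast_lt_one_iff.2 hn
      push_cast at this
      rw [Int.cast_mul, norm_mul, Int.cast_ofNat] at h_two
      simpa [h_two, one_add_one_eq_two, map_ofNat] using this)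
  have h_sq : r ^ 2 = n := by simpa [sub_eq_zero] using hr
  exact ⟨r, by exact_mod_cast congrArg ((↑) : ℤ_[p] → ℚ_[p]) h_sq⟩

end Padic

section NormValuation

variable {F E : Type*} [Field F] [Field E] [Algebra F E]

theorem leftMulMatrix_root (B : Module.Basis (Fin 3) F E) {l : E} (hB : ∀ i, B i = l ^ (i : ℕ))
    (hl : l ^ 3 - l ^ 2 + 1 = 0) :
    Algebra.leftMulMatrix B l = !![0, 0, -1; 1, 0, 0; 0, 1, 1] := by
  have h0 : l * B 0 = B 1 := by simp [hB]
  have h1 : l * B 1 = B 2 := by simp [hB, pow_two]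
  have h2 : l * B 2 = B 2 - B 0 := by
    simp only [hB, Fin.val_two, Fin.val_zero]
    linear_combination hl
  ext i j
  rw [Algebra.leftMulMatrix_eq_repr_mul]
  fin_cases j
  · fin_cases i <;> simp [h0]
  · fin_cases i <;> simp [h1]
  · fin_cases i <;> simp [h2]

theorem norm_eq_cubicNormForm (B : Module.Basis (Fin 3) F E) {l : E}
    (hB : ∀ i, B i = l ^ (i : ℕ)) (hl : l ^ 3 - l ^ 2 + 1 = 0) (e : E) :
    Algebra.norm F e = cubicNormForm (B.repr e 0) (B.repr e 1) (B.repr e 2) := by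
  conv_lhs => rw [← B.sum_repr e]
  generalize B.repr e = r
  simp only [Fin.sum_univ_three, hB, Algebra.norm_eq_matrix_det B, map_add, map_smul, map_pow,
    leftMulMatrix_root B hB hl, Matrix.det_fin_three, cubicNormForm]
  simp [pow_two, Matrix.one_fin_three]
  ring

variable {Γ₀ : Type*} [LinearOrderedCommGroupWithZero Γ₀]

/-- The composition of a valuation with the norm of a finite extension; it is a valuation as soon
as it satisfies the ultrametric inequality. -/
noncomputable def normValuation [FiniteDimensional F E] (v : Valuation F Γ₀)
    (h_add : ∀ x y : E, v (Algebra.norm F (x + y)) ≤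
      max (v (Algebra.norm F x)) (v (Algebra.norm F y))) : Valuation E Γ₀ where
  toFun e := v (Algebra.norm F e)
  map_zero' := by rw [Algebra.norm_zero, map_zero]
  map_one' := by rw [map_one, map_one]
  map_mul' x y := by rw [map_mul, map_mul]
  map_add_le_max' := h_add

theorem CubicCyclicAlgebra.isUnit_of_norm_eq_cube (hE : Module.finrank F E = 3) {σ : E ≃ₐ[F] E}
    {hσ : σ ^ 3 = 1} {u : F} (v : Valuation F Γ₀) (hu : ∀ a, v a ^ 3 ≠ v u)
    (h_cube : ∀ e : E, ∃ a, v (Algebra.norm F e) = v a ^ 3)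
    (h_add : ∀ x y : E, v (Algebra.norm F (x + y)) ≤
      max (v (Algebra.norm F x)) (v (Algebra.norm F y)))
    {x : CubicCyclicAlgebra σ hσ u} (hx : x ≠ 0) : IsUnit x := by
  have : FiniteDimensional F E := .of_finrank_pos (by simp [hE])
  refine isUnit_of_ne_zero (normValuation v h_add) (fun e => ?_) (fun e => ?_) hx
  · exact congrArg v (Algebra.norm_eq_of_algEquiv σ e)
  · obtain ⟨a, ha⟩ := h_cube e
    change v (Algebra.norm F e) ^ 3 ≠ v (Algebra.norm F (algebraMap F E u))
    rw [Algebra.norm_algebraMap, hE, map_pow, ha]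
    exact fun h => hu a ((pow_left_inj₀ zero_le zero_le three_ne_zero).1 h)

theorem CubicCyclicAlgebra.isUnit_of_valuation_cubicNormForm (B : Module.Basis (Fin 3) F E) {l : E}
    (hB : ∀ i, B i = l ^ (i : ℕ)) (hl : l ^ 3 - l ^ 2 + 1 = 0) {σ : E ≃ₐ[F] E}
    {hσ : σ ^ 3 = 1} {u : F} (v : Valuation F Γ₀) (hu : ∀ a, v a ^ 3 ≠ v u)
    (hv : ∀ a b c : F, v (cubicNormForm a b c) = max (v a) (max (v b) (v c)) ^ 3)
    {x : CubicCyclicAlgebra σ hσ u} (hx : x ≠ 0) : IsUnit x := by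
  have hE : Module.finrank F E = 3 := by simp [Module.finrank_eq_card_basis B]
  refine isUnit_of_norm_eq_cube hE v hu (fun e => ?_) (fun x y => ?_) hx
  · rw [norm_eq_cubicNormForm B hB hl, hv]
    grind
  · simp only [norm_eq_cubicNormForm B hB hl, hv, map_add, Finsupp.add_apply]
    rw [← (pow_left_mono 3).map_max]
    have h := fun i => v.map_add (B.repr x i) (B.repr y i)
    exact pow_le_pow_left₀ zero_le (by grind) 3

end NormValuation

section PositiveDefinite

open scoped ComplexOrder MatrixOrder Matrix.Norms.L2Operator

variable {n 𝕜 : Type*} [Fintype n] [RCLike 𝕜]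

theorem posDef_of_sum_row_lt_diag [DecidableEq n] {A : Matrix n n 𝕜} (hA : A.IsHermitian)
    (h : ∀ k, ∑ j ∈ Finset.univ.erase k, ‖A k j‖ < RCLike.re (A k k)) : A.PosDef := by
  refine hA.posDef_iff_eigenvalues_pos.2 fun i => ?_
  have h_eig : Module.End.HasEigenvalue (Matrix.toLin' A) (hA.eigenvalues i : 𝕜) := by
    rw [Module.End.hasEigenvalue_iff_mem_spectrum, Matrix.spectrum_toLin']
    exact hA.spectrum_eq_image_range ▸ ⟨_, ⟨i, rfl⟩, rfl⟩
  obtain ⟨k, hk⟩ := eigenvalue_mem_ball h_eig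
  rw [Metric.mem_closedBall', dist_eq_norm] at hk
  have h_re := (RCLike.re_le_norm (A k k - hA.eigenvalues i)).trans_lt (hk.trans_lt (h k))
  rw [map_sub, RCLike.ofReal_re] at h_re
  linarith

theorem trace_mul_pos_of_adjoint {S X Y : Matrix n n 𝕜} (hS : S.PosDef)
    (hXY : S * Y = star X * S) (hX : X ≠ 0) : 0 < (Y * X).trace := by
  classical
  obtain ⟨C, ⟨C, rfl⟩, rfl⟩ := CStarAlgebra.isStrictlyPositive_iff_eq_star_mul_self.1
    hS.isStrictlyPositive
  set W : Matrix n n 𝕜 := C * X * ((C⁻¹ : (Matrix n n 𝕜)ˣ) : Matrix n n 𝕜) with hW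
  have hY : C * Y = star W * C := by
    refine C.isUnit.star.mul_left_cancel ?_
    have h_inv : star (C : Matrix n n 𝕜) * star ((C⁻¹ : (Matrix n n 𝕜)ˣ) : Matrix n n 𝕜) = 1 := by
      rw [← star_mul, Units.inv_mul, star_one]
    simp only [hW, star_mul, ← mul_assoc, hXY, h_inv, one_mul]
  have h_trace : (Y * X).trace = (star W * W).trace := by
    rw [← Matrix.trace_units_conj C (Y * X), ← mul_assoc, hY, hW]
    simp only [mul_assoc]
  have hW_ne : W ≠ 0 := by
    simpa only [hW, ne_eq, Units.mul_left_eq_zero, Units.mul_right_eq_zero] using hX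
  rw [h_trace, Matrix.star_eq_conjTranspose]
  exact (Matrix.posSemidef_conjTranspose_mul_self W).trace_nonneg.lt_of_ne'
    (mt Matrix.trace_conjTranspose_mul_self_eq_zero_iff.1 hW_ne)

end PositiveDefinite

section Twist

variable {B : Type*} [Ring B] [Algebra ℚ B]

/-- The anti-involution `x ↦ t⁻¹ φ(x) t`, for a unit `t` fixed by `φ`. -/
def twist (φ : B →ₗ[ℚ] B) (t : Bˣ) : B →ₗ[ℚ] B :=
  LinearMap.mulRight ℚ (t : B) ∘ₗ LinearMap.mulLeft ℚ ((t⁻¹ : Bˣ) : B) ∘ₗ φ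

theorem twist_apply (φ : B →ₗ[ℚ] B) (t : Bˣ) (x : B) : twist φ t x = ↑t⁻¹ * φ x * t :=
  rfl

theorem IsAntiInvolution.twist {φ : B →ₗ[ℚ] B} (hφ : IsAntiInvolution φ) {t : Bˣ} (ht : φ t = t) :
    IsAntiInvolution (twist φ t) := by
  have h_inv : φ ↑t⁻¹ = ↑t⁻¹ := by
    refine (Units.inv_eq_of_mul_eq_one_right ?_).symm
    rw [← hφ.map_one, ← Units.inv_mul t, hφ.map_mul, ht]
  constructor
  · simp [twist_apply, hφ.map_one]
  · intro x
    simp [twist_apply, hφ.map_mul, hφ.involutive, h_inv, ht, mul_assoc]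
  · intro x y
    simp [twist_apply, hφ.map_mul, mul_assoc]

theorem twist_apply_of_mem_center (φ : B →ₗ[ℚ] B) (t : Bˣ) {x : B}
    (hx : φ x ∈ Subalgebra.center ℚ B) : twist φ t x = φ x := by
  rw [twist_apply, Subalgebra.mem_center_iff.1 hx, mul_assoc, Units.inv_mul, mul_one]

end Twist

theorem trace_prod {R M N : Type*} [CommRing R] [AddCommGroup M] [Module R M] [AddCommGroup N]
    [Module R N] [Module.Free R M] [Module.Finite R M] [Module.Free R N] [Module.Finite R N]
    (f : M × N →ₗ[R] M × N) :
    LinearMap.trace R (M × N) f =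
      LinearMap.trace R M (LinearMap.fst R M N ∘ₗ f ∘ₗ LinearMap.inl R M N) +
        LinearMap.trace R N (LinearMap.snd R M N ∘ₗ f ∘ₗ LinearMap.inr R M N) := by
  have h_split : f = (f ∘ₗ LinearMap.inl R M N) ∘ₗ LinearMap.fst R M N +
      (f ∘ₗ LinearMap.inr R M N) ∘ₗ LinearMap.snd R M N := by
    refine LinearMap.ext fun x => ?_
    simp [← map_add]
  conv_lhs => rw [h_split, map_add, LinearMap.trace_comp_comm' (LinearMap.fst R M N),
    LinearMap.trace_comp_comm' (LinearMap.snd R M N)]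

namespace CubicCyclicAlgebra

variable {F E : Type*} [Field F] [Field E] [Algebra F E]
variable {σ : E ≃ₐ[F] E} {hσ : σ ^ 3 = 1} {u : F}

theorem trace_mulLeft (K : Type*) [Field K] [Algebra K F] [Algebra K E] [IsScalarTower K F E]
    [FiniteDimensional K E] (y : CubicCyclicAlgebra σ hσ u) :
    LinearMap.trace K (CubicCyclicAlgebra σ hσ u) (LinearMap.mulLeft K y) =
      Algebra.trace K E (y.c0 + σ y.c0 + σ (σ y.c0)) := by
  rw [← LinearMap.trace_conj' _ (coeffEquiv K), trace_prod, trace_prod, ← add_assoc, map_add,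
    map_add]
  simp only [Algebra.trace_apply]
  congr 2 <;> congr 1 <;> ext <;> simp [coeffEquiv, LinearEquiv.conj_apply]

section Matrix

/-- The matrix of left multiplication by `x` on the right `E`-space with basis `1, v, v²`, mapped
to `R` by `j`. -/
def toMatrix {R : Type*} [CommRing R] (j : E →+* R) (x : CubicCyclicAlgebra σ hσ u) :
    Matrix (Fin 3) (Fin 3) R :=
  !![j x.c0, j (algebraMap F E u) * j (σ x.c2), j (algebraMap F E u) * j (σ (σ x.c1));
    j x.c1, j (σ x.c0), j (algebraMap F E u) * j (σ (σ x.c2));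
    j x.c2, j (σ x.c1), j (σ (σ x.c0))]

variable {R : Type*} [CommRing R] (j : E →+* R)

theorem toMatrix_mul (x y : CubicCyclicAlgebra σ hσ u) :
    toMatrix j (x * y) = toMatrix j x * toMatrix j y := by
  ext i k
  fin_cases i <;> fin_cases k <;>
    simp [toMatrix, Matrix.mul_apply, Fin.sum_univ_three, apply_three hσ] <;> ring

theorem toMatrix_ne_zero [Nontrivial R] {x : CubicCyclicAlgebra σ hσ u} (hx : x ≠ 0) :
    toMatrix j x ≠ 0 := by
  contrapose! hx
  have h_col : ∀ i, toMatrix j x i 0 = 0 := fun i => congrFun (congrFun hx i) 0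
  exact CubicCyclicAlgebra.ext (j.injective (by simpa [toMatrix] using h_col 0))
    (j.injective (by simpa [toMatrix] using h_col 1))
    (j.injective (by simpa [toMatrix] using h_col 2))

theorem trace_toMatrix (x : CubicCyclicAlgebra σ hσ u) :
    (toMatrix j x).trace = j (x.c0 + σ x.c0 + σ (σ x.c0)) := by
  simp [toMatrix, Matrix.trace_fin_three]

end Matrix

end CubicCyclicAlgebra

namespace CubicCyclicAlgebra

section Involution

variable {F E : Type*} [Field F] [Field E] [Algebra F E] [Algebra ℚ F] [Algebra ℚ E]
variable {σ : E ≃ₐ[F] E} {hσ : σ ^ 3 = 1} {u : F} {τ : E →+* E}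

/-- The additive map extending `τ` by `v ↦ v` that reverses products when `τ σ = σ⁻¹ τ`; as
`τ(e) v = v σ(τ(e))`, it maps `v e` to `v σ(τ(e))`. -/
def antiExtension (τ : E →+* E) : CubicCyclicAlgebra σ hσ u →ₗ[ℚ] CubicCyclicAlgebra σ hσ u where
  toFun x := ⟨τ x.c0, σ (τ x.c1), σ (σ (τ x.c2))⟩
  map_add' x y := by ext <;> simp
  map_smul' q x := by ext <;> simp [map_rat_smul]

theorem isAntiInvolution_antiExtension (hτ : Function.Involutive τ)
    (hτσ : ∀ e, τ (σ e) = σ (σ (τ e))) (hτu : τ (algebraMap F E u) = algebraMap F E u) :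
    IsAntiInvolution (antiExtension τ : CubicCyclicAlgebra σ hσ u →ₗ[ℚ] _) := by
  refine ⟨?_, fun x => ?_, fun x y => ?_⟩
  · ext <;> simp [antiExtension]
  · ext <;> simp [antiExtension, hτσ, hτ _, apply_three hσ]
  · ext <;> simp [antiExtension, hτσ, hτu, apply_three hσ] <;> ring

theorem isOfSecondKind_twist_antiExtension {δ : F} (hτδ : τ (algebraMap F E δ) ≠ algebraMap F E δ)
    (hδ : τ (algebraMap F E δ) ∈ (algebraMap F E).range) (t : (CubicCyclicAlgebra σ hσ u)ˣ) :
    IsOfSecondKind (twist (antiExtension τ) t) := by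
  obtain ⟨ε, hε⟩ := hδ
  have h_center (a : F) :
      (⟨algebraMap F E a, 0, 0⟩ : CubicCyclicAlgebra σ hσ u) ∈ Subalgebra.center ℚ _ :=
    Subalgebra.mem_center_iff.2 fun b => (Algebra.commutes a b).symm
  have h_map : antiExtension τ (⟨algebraMap F E δ, 0, 0⟩ : CubicCyclicAlgebra σ hσ u) =
      ⟨algebraMap F E ε, 0, 0⟩ := by
    ext <;> simp [antiExtension, hε]
  refine ⟨⟨algebraMap F E δ, 0, 0⟩, h_center δ, ?_⟩
  rw [twist_apply_of_mem_center _ _ (h_map ▸ h_center ε), h_map, hε]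
  exact fun h => hτδ (congrArg c0 h)

/-- The Gram matrix, in the basis `1, v, v²` with `v³ = U`, of the form for which `antiExtension`
is the adjoint. -/
def gramMatrix {R : Type*} [CommRing R] (U : R) : Matrix (Fin 3) (Fin 3) R :=
  !![1, 0, 0; 0, 0, U; 0, U, 0]

theorem star_gramMatrix {R : Type*} [CommRing R] [StarRing R] {U : R} (hU : star U = U) :
    star (gramMatrix U) = gramMatrix U := by
  ext i k
  fin_cases i <;> fin_cases k <;> simp [gramMatrix, Matrix.star_apply, hU]

theorem gramMatrix_mul_toMatrix_antiExtension {R : Type*} [CommRing R] [StarRing R] {j : E →+* R}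
    (hj : ∀ e, j (τ e) = star (j e)) (hτσ : ∀ e, τ (σ e) = σ (σ (τ e)))
    (hτu : τ (algebraMap F E u) = algebraMap F E u) (x : CubicCyclicAlgebra σ hσ u) :
    gramMatrix (j (algebraMap F E u)) * toMatrix j (antiExtension τ x) =
      star (toMatrix j x) * gramMatrix (j (algebraMap F E u)) := by
  ext i k
  fin_cases i <;> fin_cases k <;>
    simp [gramMatrix, toMatrix, antiExtension, Matrix.mul_apply, Matrix.star_apply,
      Fin.sum_univ_three, ← hj, hτσ, hτu, apply_three hσ] <;> ring

end Involution

section Positivity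

open scoped ComplexOrder

variable {F E : Type*} [Field F] [Field E] [Algebra F E] [Algebra ℚ F] [Algebra ℚ E]
variable {σ : E ≃ₐ[F] E} {hσ : σ ^ 3 = 1} {u : F} {τ : E →+* E} {j : E →+* ℂ}

theorem antiExtension_symmetric (hτσ : ∀ e, τ (σ e) = σ (σ (τ e))) {p : E} (hp : τ p = p) :
    antiExtension τ (⟨p, σ (σ p), σ p⟩ : CubicCyclicAlgebra σ hσ u) = ⟨p, σ (σ p), σ p⟩ := by
  ext <;> simp [antiExtension, hτσ, hp, apply_three hσ]

/-- The matrix is strictly diagonally dominant. -/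
theorem posDef_gramMatrix_mul_toMatrix (hj : ∀ e, j (τ e) = star (j e))
    (hτσ : ∀ e, τ (σ e) = σ (σ (τ e))) {U : ℝ} (hU : j (algebraMap F E u) = U) (hU1 : 1 ≤ U)
    {p : E} (hp : τ p = p) (hpU : 2 * U * ‖j (σ p)‖ < (j p).re) :
    (gramMatrix (U : ℂ) *
      toMatrix j (⟨p, σ (σ p), σ p⟩ : CubicCyclicAlgebra σ hσ u)).PosDef := by
  have hτu : τ (algebraMap F E u) = algebraMap F E u := j.injective (by simp [hj, hU])
  have h_gram := star_gramMatrix (U := (U : ℂ)) (Complex.conj_ofReal U)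
  have h_adj := gramMatrix_mul_toMatrix_antiExtension hj hτσ hτu
    (⟨p, σ (σ p), σ p⟩ : CubicCyclicAlgebra σ hσ u)
  rw [antiExtension_symmetric hτσ hp, hU] at h_adj
  have h_norm : ‖j (σ (σ p))‖ = ‖j (σ p)‖ := by
    rw [← norm_star (j (σ p)), ← hj, hτσ, hp]
  refine posDef_of_sum_row_lt_diag ?_ fun k => ?_
  · rw [Matrix.IsHermitian, ← Matrix.star_eq_conjTranspose, star_mul, h_gram, h_adj]
  · have h_re : 0 ≤ (j p).re := (by positivity : 0 ≤ 2 * U * ‖j (σ p)‖).trans hpU.le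
    have h_re_le : (j p).re ≤ U * (j p).re := le_mul_of_one_le_left h_re hU1
    have h_re_le' : U * (j p).re ≤ U * (U * (j p).re) := by gcongr
    fin_cases k <;>
      simp [gramMatrix, toMatrix, Matrix.mul_apply, Fin.sum_univ_three, hU, apply_three hσ, h_norm,
        Finset.sum_erase_eq_sub, abs_of_pos (one_pos.trans_le hU1)] <;>
      linarith [le_mul_of_one_le_left (norm_nonneg (j (σ p))) hU1]

theorem trace_mulLeft_pos [FiniteDimensional ℚ E] (hj : ∀ e, j (τ e) = star (j e))
    (hfix : ∀ e, σ e = e → τ e = e → e ∈ (algebraMap ℚ E).range) {y : CubicCyclicAlgebra σ hσ u}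
    (hy : 0 < (toMatrix j y).trace) :
    0 < LinearMap.trace ℚ (CubicCyclicAlgebra σ hσ u) (LinearMap.mulLeft ℚ y) := by
  rw [trace_toMatrix] at hy
  rw [trace_mulLeft]
  generalize hs : y.c0 + σ y.c0 + σ (σ y.c0) = s at *
  have hσs : σ s = s := by
    rw [← hs, map_add, map_add, apply_three hσ]
    ring
  have hτs : τ s = s := j.injective (by rw [hj, (IsSelfAdjoint.of_nonneg hy.le).star_eq])
  obtain ⟨q, rfl⟩ := hfix s hσs hτs
  have hq : (0 : ℝ) < q := by
    rw [eq_ratCast, map_ratCast] at hy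
    exact_mod_cast (Complex.pos_iff.1 hy).1
  rw [Algebra.trace_algebraMap]
  exact nsmul_pos (by exact_mod_cast hq) Module.finrank_pos.ne'

theorem isPositiveAntiInvolution_twist [FiniteDimensional ℚ E] (hj : ∀ e, j (τ e) = star (j e))
    (hτσ : ∀ e, τ (σ e) = σ (σ (τ e)))
    (hfix : ∀ e, σ e = e → τ e = e → e ∈ (algebraMap ℚ E).range)
    {U : ℝ} (hU : j (algebraMap F E u) = U) (hU1 : 1 ≤ U)
    {p : E} (hp : τ p = p) (hpU : 2 * U * ‖j (σ p)‖ < (j p).re)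
    (t : (CubicCyclicAlgebra σ hσ u)ˣ) (ht : t = (⟨p, σ (σ p), σ p⟩ : CubicCyclicAlgebra σ hσ u)) :
    IsPositiveAntiInvolution (twist (antiExtension τ) t) := by
  have hτ : Function.Involutive τ := fun e => j.injective (by rw [hj, hj, star_star])
  have hτu : τ (algebraMap F E u) = algebraMap F E u := j.injective (by simp [hj, hU])
  refine ⟨(isAntiInvolution_antiExtension hτ hτσ hτu).twist ?_, fun x hx => ?_⟩
  · rw [ht, antiExtension_symmetric hτσ hp]
  have hS := posDef_gramMatrix_mul_toMatrix (hσ := hσ) hj hτσ hU hU1 hp hpU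
  refine trace_mulLeft_pos hj hfix ?_
  rw [toMatrix_mul]
  refine trace_mul_pos_of_adjoint hS ?_ (toMatrix_ne_zero j hx)
  have h_adj := gramMatrix_mul_toMatrix_antiExtension hj hτσ hτu x
  rw [hU] at h_adj
  rw [← ht, mul_assoc, ← toMatrix_mul, twist_apply, mul_assoc, Units.mul_inv_cancel_left,
    toMatrix_mul, ← mul_assoc, h_adj, mul_assoc]

end Positivity

end CubicCyclicAlgebra

section SquareDiscriminant

open Polynomial IntermediateField

variable {F E : Type*} [Field F] [Field E] [Algebra F E] {P : Cubic F} {l m n : E}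

theorem roots_eq_of_ne {P : Cubic E} (hl : l ∈ P.roots) (hm : m ∈ P.roots) (hn : n ∈ P.roots)
    (hlm : l ≠ m) (hln : l ≠ n) (hmn : m ≠ n) : P.roots = {l, m, n} := by
  refine (Multiset.eq_of_le_of_card_le ?_ ?_).symm
  · refine (Multiset.le_iff_subset ?_).2 ?_
    · simp [hlm, hln, hmn]
    · simp [Multiset.subset_iff, hl, hm, hn]
  · refine (card_roots' _).trans ?_
    change P.toPoly.natDegree ≤ 3
    rw [Cubic.toPoly]
    compute_degree

theorem exists_algebraMap_eq_prod_sub_roots (ha : P.a ≠ 0)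
    (h_roots : (P.map (algebraMap F E)).roots = {l, m, n}) (h_sq : IsSquare P.discr) :
    ∃ d : F, algebraMap F E d = (l - m) * (l - n) * (m - n) := by
  obtain ⟨d, hd⟩ := h_sq
  have ha' : algebraMap F E P.a ≠ 0 := by simpa using ha
  have h_discr := Cubic.discr_eq_prod_three_roots ha h_roots
  rw [hd, ← pow_two, map_pow, sq_eq_sq_iff_eq_or_eq_neg] at h_discr
  obtain h | h := h_discr
  · refine ⟨d / P.a ^ 2, ?_⟩
    rw [map_div₀, h, map_pow]
    field_simp
  · refine ⟨-d / P.a ^ 2, ?_⟩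
    rw [map_div₀, map_neg, h, map_pow]
    field_simp

theorem mem_adjoin_root_of_isSquare_discr (h2 : (2 : E) ≠ 0) (ha : P.a ≠ 0)
    (h_roots : (P.map (algebraMap F E)).roots = {l, m, n}) (h_sq : IsSquare P.discr)
    (h0 : P.discr ≠ 0) : m ∈ F⟮l⟯ := by
  obtain ⟨hlm, hln, -⟩ := (Cubic.discr_ne_zero_iff_roots_ne ha h_roots).1 h0
  obtain ⟨d, hd⟩ := exists_algebraMap_eq_prod_sub_roots ha h_roots h_sq
  have ha' : algebraMap F E P.a ≠ 0 := by simpa using ha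
  have hl : l ∈ F⟮l⟯ := mem_adjoin_simple_self F l
  have h_sum : m + n ∈ F⟮l⟯ := by
    have : m + n = algebraMap F E (-P.b / P.a) - l := by
      rw [map_div₀, map_neg, Cubic.b_eq_three_roots ha h_roots]
      field_simp
      ring
    exact this ▸ sub_mem (F⟮l⟯.algebraMap_mem _) hl
  have h_mul : m * n ∈ F⟮l⟯ := by
    have : m * n = algebraMap F E (P.c / P.a) - l * (m + n) := by
      rw [map_div₀, Cubic.c_eq_three_roots ha h_roots]
      field_simp
      ring
    exact this ▸ sub_mem (F⟮l⟯.algebraMap_mem _) (mul_mem hl h_sum)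
  have h_diff : m - n = algebraMap F E d / (l ^ 2 - l * (m + n) + m * n) := by
    have : l ^ 2 - l * (m + n) + m * n = (l - m) * (l - n) := by ring
    rw [hd, this, mul_div_cancel_left₀ _ (mul_ne_zero (sub_ne_zero.2 hlm) (sub_ne_zero.2 hln))]
  have h_half : m = ((m + n) + (m - n)) / 2 := by
    field_simp
    ring
  rw [h_half, h_diff]
  exact div_mem (add_mem h_sum (div_mem (F⟮l⟯.algebraMap_mem _)
    (add_mem (sub_mem (pow_mem hl 2) (mul_mem hl h_sum)) h_mul))) (ofNat_mem _ 2)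

theorem map_root_mem_roots (g : E →ₐ[F] E) {x : E} (hx : x ∈ (P.map (algebraMap F E)).roots) :
    g x ∈ (P.map (algebraMap F E)).roots := by
  rw [Cubic.map_roots] at hx ⊢
  rw [← aroots, mem_aroots] at hx ⊢
  exact ⟨hx.1, by rw [aeval_algHom_apply, hx.2, map_zero]⟩

theorem algHom_rotates_roots (h2 : (2 : E) ≠ 0) (ha : P.a ≠ 0)
    (h_roots : (P.map (algebraMap F E)).roots = {l, m, n}) (h_sq : IsSquare P.discr)
    (h0 : P.discr ≠ 0) {g : E →ₐ[F] E} (hgl : g l = m) : g m = n ∧ g n = l := by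
  obtain ⟨hlm, hln, hmn⟩ := (Cubic.discr_ne_zero_iff_roots_ne ha h_roots).1 h0
  have h_perm {x : E} (hx : x ∈ ({l, m, n} : Multiset E)) : g x = l ∨ g x = m ∨ g x = n := by
    have := map_root_mem_roots g (h_roots ▸ hx)
    simpa [h_roots] using this
  have h_m := h_perm (x := m) (by simp)
  have h_n := h_perm (x := n) (by simp)
  have h_ne {x y : E} (h : x ≠ y) : g x ≠ g y := g.injective.ne h
  -- a transposition of the roots would change the sign of the square root of the discriminant
  have h_gm : g m ≠ l := by
    intro h_swap
    have h_gn : g n = n := by grind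
    obtain ⟨d, hd⟩ := exists_algebraMap_eq_prod_sub_roots ha h_roots h_sq
    have h_fix : g ((l - m) * (l - n) * (m - n)) = (l - m) * (l - n) * (m - n) := by
      rw [← hd, g.commutes]
    simp only [map_mul, map_sub, hgl, h_swap, h_gn] at h_fix
    refine mul_ne_zero h2 (mul_ne_zero (mul_ne_zero (sub_ne_zero.2 hlm) (sub_ne_zero.2 hln))
      (sub_ne_zero.2 hmn)) ?_
    linear_combination -h_fix
  grind

theorem exists_powerBasis_gen_eq (h_int : IsIntegral F l) (h_top : F⟮l⟯ = ⊤) :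
    ∃ pb : PowerBasis F E, pb.gen = l :=
  ⟨(adjoin.powerBasis h_int).map ((equivOfEq h_top).trans topEquiv), rfl⟩

theorem exists_basis_pow (h_int : IsIntegral F l) (h_top : F⟮l⟯ = ⊤) {d : ℕ}
    (hd : (minpoly F l).natDegree = d) :
    ∃ B : Module.Basis (Fin d) F E, ∀ i, B i = l ^ (i : ℕ) := by
  obtain ⟨pb, rfl⟩ := exists_powerBasis_gen_eq h_int h_top
  exact ⟨pb.basis.reindex (finCongr (pb.natDegree_minpoly.symm.trans hd)), fun i => by simp⟩

theorem exists_algEquiv_rotating_roots (h_top : F⟮l⟯ = ⊤) (h2 : (2 : E) ≠ 0)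
    (hP : Irreducible P.toPoly) (ha : P.a ≠ 0)
    (h_roots : (P.map (algebraMap F E)).roots = {l, m, n}) (h_sq : IsSquare P.discr)
    (h0 : P.discr ≠ 0) : ∃ σ : E ≃ₐ[F] E, σ ^ 3 = 1 ∧ σ l = m ∧ σ m = n ∧ σ n = l := by
  have h_root {x : E} (hx : x ∈ ({l, m, n} : Multiset E)) : aeval x P.toPoly = 0 :=
    (mem_aroots.1 (by rwa [aroots, ← Cubic.map_roots, h_roots])).2
  have h_int : IsIntegral F l := IsAlgebraic.isIntegral ⟨_, hP.ne_zero, h_root (by simp)⟩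
  obtain ⟨pb, rfl⟩ := exists_powerBasis_gen_eq h_int h_top
  have := pb.finite
  obtain ⟨g, hgl⟩ : ∃ g : E →ₐ[F] E, g pb.gen = m := by
    refine ⟨pb.lift m ?_, pb.lift_gen m _⟩
    rw [← minpoly.eq_of_irreducible hP (h_root (by simp)), map_mul, h_root (by simp), zero_mul]
  obtain ⟨hgm, hgn⟩ := algHom_rotates_roots h2 ha h_roots h_sq h0 hgl
  let σ := AlgEquiv.ofBijective g (Algebra.IsAlgebraic.algHom_bijective g)
  have h_cube : ((σ ^ 3 : E ≃ₐ[F] E) : E →ₐ[F] E) = ((1 : E ≃ₐ[F] E) : E →ₐ[F] E) :=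
    pb.algHom_ext (by simp [pow_succ, σ, hgl, hgm, hgn])
  exact ⟨σ, AlgEquiv.coe_toAlgHom_injective h_cube, hgl, hgm, hgn⟩

end SquareDiscriminant

section DefiningCubic

open Polynomial

/-- The polynomial `X³ - X² + 1`, as a `Cubic` so that Mathlib's discriminant applies to it. -/
def definingCubic (K : Type*) [CommRing K] : Cubic K :=
  ⟨1, -1, 0, 1⟩

theorem map_definingCubic {K L : Type*} [CommRing K] [CommRing L] (f : K →+* L) :
    (definingCubic K).map f = definingCubic L := by
  simp [definingCubic, Cubic.map]

variable {K : Type*} [Field K]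

theorem monic_definingCubic : (definingCubic K).toPoly.Monic :=
  Cubic.monic_of_a_eq_one rfl

theorem discr_definingCubic : (definingCubic K).discr = -23 := by
  norm_num [Cubic.discr, definingCubic]

theorem mem_roots_definingCubic {x : K} :
    x ∈ (definingCubic K).roots ↔ x ^ 3 - x ^ 2 + 1 = 0 := by
  rw [Cubic.mem_roots_iff monic_definingCubic.ne_zero, definingCubic]
  ring_nf

theorem irreducible_definingCubic {Γ₀ : Type*} [LinearOrderedCommGroupWithZero Γ₀]
    (v : Valuation K Γ₀)
    (hv : ∀ a b c : K, v (cubicNormForm a b c) = max (v a) (max (v b) (v c)) ^ 3) :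
    Irreducible (definingCubic K).toPoly := by
  have h_deg : (definingCubic K).toPoly.natDegree = 3 :=
    Cubic.natDegree_of_a_ne_zero (one_ne_zero : (1 : K) ≠ 0)
  refine irreducible_of_degree_le_three_of_not_isRoot (by simp [h_deg]) fun x hx => ?_
  rw [← mem_roots monic_definingCubic.ne_zero] at hx
  -- the norm of `x - X` is the value of the cubic at `x`
  have h_zero : cubicNormForm x (-1) 0 = 0 := by
    rw [cubicNormForm]
    linear_combination mem_roots_definingCubic.1 hx
  have h_max := hv x (-1) 0
  rw [h_zero, map_zero, Valuation.map_neg, map_one, eq_comm] at h_max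
  have h_le : (1 : Γ₀) ≤ max (v x) (max 1 0) := le_max_of_le_right (le_max_left _ _)
  exact (one_pos.trans_le h_le).ne' (eq_zero_of_pow_eq_zero h_max)

end DefiningCubic

section ComplexRoots

variable {lam : ℝ} (hlam : lam ^ 3 - lam ^ 2 + 1 = 0)
include hlam

theorem neg_one_lt_of_root : -1 < lam := by
  nlinarith [sq_nonneg (lam - 1)]

theorem neg_of_root : lam < 0 := by
  nlinarith [sq_nonneg (lam - 1), sq_nonneg lam]

theorem real_root_unique {x : ℝ} (hx : x ^ 3 - x ^ 2 + 1 = 0) : x = lam := by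
  have h_lam := neg_of_root hlam
  have h_x := neg_of_root hx
  have h_quad : 0 < x ^ 2 + x * lam + lam ^ 2 - x - lam := by nlinarith
  have h_mul : (x - lam) * (x ^ 2 + x * lam + lam ^ 2 - x - lam) = 0 := by
    linear_combination hx - hlam
  exact sub_eq_zero.1 ((mul_eq_zero.1 h_mul).resolve_right h_quad.ne')

variable {z : ℂ} (hz : z ^ 3 - z ^ 2 + 1 = 0) (hz_ne : z ≠ lam)
include hz hz_ne

theorem conj_root_ne : starRingEnd ℂ z ≠ z := by
  intro h
  obtain ⟨x, rfl⟩ := Complex.conj_eq_iff_real.1 h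
  exact hz_ne (congrArg _ (real_root_unique hlam (by exact_mod_cast hz)))

theorem roots_definingCubic_complex :
    (definingCubic ℂ).roots = {(lam : ℂ), z, starRingEnd ℂ z} := by
  have hz' := congrArg (starRingEnd ℂ) hz
  simp only [map_add, map_sub, map_pow, map_one, map_zero] at hz'
  refine roots_eq_of_ne (mem_roots_definingCubic.2 (by exact_mod_cast hlam))
    (mem_roots_definingCubic.2 hz) (mem_roots_definingCubic.2 hz') hz_ne.symm (fun h => ?_)
    (conj_root_ne hlam hz hz_ne).symm
  exact hz_ne (by rw [← Complex.conj_conj z, ← h, Complex.conj_ofReal])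

theorem norm_one_sub_root_sq : ‖1 - z‖ ^ 2 = lam ^ 2 := by
  have h_roots : ((definingCubic ℂ).map (RingHom.id ℂ)).roots =
      {(lam : ℂ), z, starRingEnd ℂ z} := by
    rw [map_definingCubic, roots_definingCubic_complex hlam hz hz_ne]
  have ha : (definingCubic ℂ).a ≠ 0 := one_ne_zero
  have h_sum := Cubic.b_eq_three_roots ha h_roots
  have h_pair := Cubic.c_eq_three_roots ha h_roots
  simp only [definingCubic, map_neg, map_one, map_zero] at h_sum h_pair
  have : ((‖1 - z‖ ^ 2 : ℝ) : ℂ) = ((lam ^ 2 : ℝ) : ℂ) := by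
    rw [← Complex.normSq_eq_norm_sq, ← Complex.mul_conj, map_sub, map_one]
    push_cast
    linear_combination (-1 - (lam : ℂ)) * h_sum - h_pair
  exact_mod_cast this

theorem six_mul_norm_one_sub_root_pow_lt : 6 * ‖(1 - z) ^ 4‖ < (1 - lam) ^ 4 := by
  have h_neg := neg_of_root hlam
  have h_norm : ‖(1 - z) ^ 4‖ = (lam ^ 2) ^ 2 := by
    rw [norm_pow, ← norm_one_sub_root_sq hlam hz hz_ne]
    ring
  have h_pos : 0 < (lam ^ 2) ^ 2 := pow_pos (sq_pos_of_neg h_neg) 2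
  have h_sq : 4 * lam ^ 2 ≤ (1 - lam) ^ 2 := by nlinarith [neg_one_lt_of_root hlam]
  calc 6 * ‖(1 - z) ^ 4‖ < (4 * lam ^ 2) ^ 2 := by
        rw [h_norm, mul_pow]
        linarith
    _ ≤ ((1 - lam) ^ 2) ^ 2 := by gcongr
    _ = (1 - lam) ^ 4 := by ring

end ComplexRoots

section Quadratic

open Polynomial IntermediateField

variable {K L M : Type*} [Field K] [Field L] [Field M] [Algebra K L] [Algebra K M]

theorem exists_eq_add_mul_of_mem_adjoin {w y : L} (hw : w ^ 2 ∈ (algebraMap K L).range)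
    (hy : y ∈ K⟮w⟯) : ∃ p q : K, y = algebraMap K L p + algebraMap K L q * w := by
  obtain ⟨a, ha⟩ := hw
  have h_monic : (X ^ 2 - C a).Monic := monic_X_pow_sub_C a two_ne_zero
  have h_root : aeval w (X ^ 2 - C a) = 0 := by simp [ha]
  have h_int : IsIntegral K w := ⟨_, h_monic, h_root⟩
  have h_dim : (adjoin.powerBasis h_int).dim ≤ 2 := by
    rw [adjoin.powerBasis_dim, ← natDegree_X_pow_sub_C (n := 2) (r := a)]
    exact natDegree_le_of_dvd (minpoly.dvd K w h_root) h_monic.ne_zero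
  obtain ⟨f, hf, h_eq⟩ := (adjoin.powerBasis h_int).exists_eq_aeval ⟨y, hy⟩
  obtain ⟨q, p, rfl⟩ := exists_eq_X_add_C_of_natDegree_le_one (by omega : f.natDegree ≤ 1)
  refine ⟨p, q, (congrArg (algebraMap K⟮w⟯ L) h_eq).trans ?_⟩
  simp [add_comm]

theorem nonempty_algHom_adjoin_of_sq {a : K} (ha : ¬ IsSquare a) {w : L}
    (hw : w ^ 2 = algebraMap K L a) {r : M} (hr : r ^ 2 = algebraMap K M a) :
    Nonempty (K⟮w⟯ →ₐ[K] M) := by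
  have h_monic : (X ^ 2 - C a).Monic := monic_X_pow_sub_C a two_ne_zero
  have h_root : aeval w (X ^ 2 - C a) = 0 := by simp [hw]
  have h_irr : Irreducible (X ^ 2 - C a) := X_pow_sub_C_irreducible_of_prime Nat.prime_two
    fun b hb => ha ⟨b, by rw [← hb, pow_two]⟩
  refine ⟨(algHomAdjoinIntegralEquiv K ⟨_, h_monic, h_root⟩).symm ⟨r, mem_aroots.2 ?_⟩⟩
  rw [← minpoly.eq_of_irreducible_of_monic h_irr h_root h_monic]
  exact ⟨h_irr.ne_zero, by simp [hr]⟩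

end Quadratic

section QuadraticField

open IntermediateField

theorem sqrt_mul_I_sq : (((Real.sqrt 23 : ℝ) : ℂ) * Complex.I) ^ 2 = -23 := by
  rw [mul_pow, Complex.I_sq, ← Complex.ofReal_pow, Real.sq_sqrt (by norm_num)]
  norm_num

theorem sqrt_mul_I_mem_fieldF : ((Real.sqrt 23 : ℝ) : ℂ) * Complex.I ∈ fieldF :=
  mem_adjoin_simple_self ℚ _

theorem isSquare_neg_twentyThree : IsSquare (-23 : fieldF) :=
  ⟨⟨_, sqrt_mul_I_mem_fieldF⟩, Subtype.ext (sqrt_mul_I_sq.symm.trans (pow_two _))⟩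

theorem finiteDimensional_fieldF : FiniteDimensional ℚ fieldF := by
  refine adjoin.finiteDimensional (.of_pow two_pos ?_)
  rw [sqrt_mul_I_sq]
  exact_mod_cast isIntegral_algebraMap (R := ℚ) (A := ℂ) (x := -23)

theorem mem_range_of_mem_fieldF_of_conj_eq {y : ℂ} (hy : y ∈ fieldF)
    (h_conj : starRingEnd ℂ y = y) : ∃ q : ℚ, y = q := by
  obtain ⟨p, q, rfl⟩ := exists_eq_add_mul_of_mem_adjoin
    ⟨-23, by simp [sqrt_mul_I_sq]⟩ hy
  have h_im := Complex.conj_eq_iff_im.1 h_conj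
  have hq : q = 0 := by simpa using h_im
  exact ⟨p, by simp [hq]⟩

theorem exists_valuation_fieldF : ∃ v : Valuation fieldF NNReal, (∀ a, v a ^ 3 ≠ v 3) ∧
    ∀ a b c, v (cubicNormForm a b c) = max (v a) (max (v b) (v c)) ^ 3 := by
  obtain ⟨r, hr⟩ := exists_padic_sq_eq_intCast (p := 3) (a := 1) (n := -23)
    (by norm_num) (by norm_num) (by norm_num)
  have h_nonsq : ¬ IsSquare (-23 : ℚ) := fun h => absurd h.nonneg (by norm_num)
  obtain ⟨g⟩ := nonempty_algHom_adjoin_of_sq h_nonsq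
    (w := ((Real.sqrt 23 : ℝ) : ℂ) * Complex.I) (by simp [sqrt_mul_I_sq]) (r := r) (by simp [hr])
  let ι : fieldF →+* ℚ_[3] := g.toRingHom
  refine ⟨NormedField.valuation.comap ι, fun a => ?_, fun a b c => ?_⟩
  · have h_three : ι 3 = 3 := map_ofNat ι 3
    simpa [h_three] using nnnorm_padic_pow_ne_nnnorm_p (p := 3) (n := 3) (by norm_num) (ι a)
  · simpa [map_cubicNormForm] using nnnorm_cubicNormForm_padic
      eq_zero_of_cubicNormForm_zmod_three_eq_zero (ι a) (ι b) (ι c)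

end QuadraticField

section SplittingField

open IntermediateField

theorem subfield_extendScalars_eq_top {L : Type*} [Field L] [CharZero L]
    {F E : IntermediateField ℚ L} (hFE : F ≤ E) {s : Set L} (hE : E = adjoin ℚ s)
    {S : Subfield (extendScalars hFE)} (hS : ∀ x : extendScalars hFE, (x : L) ∈ s → x ∈ S) :
    S = ⊤ := by
  have h_adjoin : adjoin ℚ s ≤ Subfield.toIntermediateField
      (S.map (algebraMap (extendScalars hFE) L)) (fun q => by simp) :=
    adjoin_le_iff.2 fun x hx => ⟨⟨x, hE ▸ subset_adjoin ℚ s hx⟩, hS _ hx, rfl⟩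
  refine eq_top_iff.2 fun x _ => ?_
  obtain ⟨y, hy, hyx⟩ := h_adjoin (hE ▸ x.2 : (x : L) ∈ adjoin ℚ s)
  exact Subtype.ext hyx ▸ hy

theorem irreducible_definingCubic_fieldF : Irreducible (definingCubic fieldF).toPoly :=
  let ⟨v, _, hv⟩ := exists_valuation_fieldF
  irreducible_definingCubic v hv

theorem isSquare_discr_definingCubic_fieldF : IsSquare (definingCubic fieldF).discr :=
  discr_definingCubic (K := fieldF) ▸ isSquare_neg_twentyThree

theorem discr_definingCubic_fieldF_ne_zero : (definingCubic fieldF).discr ≠ 0 := by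
  rw [discr_definingCubic]
  norm_num

variable {lam : ℝ} (hlam : lam ^ 3 - lam ^ 2 + 1 = 0) {z : ℂ} (hz : z ^ 3 - z ^ 2 + 1 = 0)
  (hz_ne : z ≠ lam)
include hlam hz hz_ne

theorem roots_subset_fieldE {x : ℂ} (hx : x ∈ (definingCubic ℂ).roots) : x ∈ fieldE lam z := by
  have h_roots := roots_definingCubic_complex hlam hz hz_ne
  have h_lam : (lam : ℂ) ∈ fieldE lam z := subset_adjoin ℚ _ (by simp)
  have h_z : z ∈ fieldE lam z := subset_adjoin ℚ _ (by simp)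
  have h_conj : starRingEnd ℂ z = 1 - lam - z := by
    have := Cubic.b_eq_three_roots (P := definingCubic ℂ) (φ := RingHom.id ℂ) one_ne_zero
      (by rw [map_definingCubic, h_roots])
    simp only [definingCubic, RingHom.id_apply] at this
    linear_combination this
  have h_mem : starRingEnd ℂ z ∈ fieldE lam z :=
    h_conj ▸ sub_mem (sub_mem (one_mem _) h_lam) h_z
  rw [h_roots] at hx
  simp only [Multiset.insert_eq_cons, Multiset.mem_cons, Multiset.mem_singleton] at hx
  rcases hx with rfl | rfl | rfl <;> assumption

theorem conj_mem_fieldE {x : ℂ} (hx : x ∈ fieldE lam z) : starRingEnd ℂ x ∈ fieldE lam z := by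
  have h_roots := roots_definingCubic_complex hlam hz hz_ne
  have h_le : fieldE lam z ≤
      (fieldE lam z).comap ((Complex.conjAe.restrictScalars ℚ : ℂ ≃ₐ[ℚ] ℂ) : ℂ →ₐ[ℚ] ℂ) := by
    refine adjoin_le_iff.2 ?_
    rintro y (rfl | rfl)
    · exact roots_subset_fieldE hlam hz hz_ne (by simp [h_roots])
    · exact roots_subset_fieldE hlam hz hz_ne (by simp [h_roots])
  exact h_le hx

theorem fieldF_le_fieldE : fieldF ≤ fieldE lam z := by
  have h_roots : ((definingCubic ℂ).map (algebraMap ℂ ℂ)).roots =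
      {(lam : ℂ), z, starRingEnd ℂ z} := by
    rw [map_definingCubic, roots_definingCubic_complex hlam hz hz_ne]
  have h_mem {x : ℂ} (hx : x ∈ ({(lam : ℂ), z, starRingEnd ℂ z} : Multiset ℂ)) :
      x ∈ fieldE lam z :=
    roots_subset_fieldE hlam hz hz_ne (by rwa [roots_definingCubic_complex hlam hz hz_ne])
  have h_prod : ((lam : ℂ) - z) * (lam - starRingEnd ℂ z) * (z - starRingEnd ℂ z) ∈
      fieldE lam z :=
    mul_mem (mul_mem (sub_mem (h_mem (by simp)) (h_mem (by simp)))
      (sub_mem (h_mem (by simp)) (h_mem (by simp)))) (sub_mem (h_mem (by simp)) (h_mem (by simp)))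
  have h_sq := Cubic.discr_eq_prod_three_roots (P := definingCubic ℂ) one_ne_zero h_roots
  rw [Algebra.algebraMap_self, RingHom.id_apply, discr_definingCubic, ← sqrt_mul_I_sq] at h_sq
  simp only [definingCubic, RingHom.id_apply, one_mul] at h_sq
  refine adjoin_le_iff.2 (Set.singleton_subset_iff.2 ?_)
  rcases sq_eq_sq_iff_eq_or_eq_neg.1 h_sq with h | h
  · exact h ▸ h_prod
  · exact h ▸ neg_mem h_prod

theorem exists_roots_extendScalars (hFE : fieldF ≤ fieldE lam z) :
    ∃ l m n : extendScalars hFE, (l : ℂ) = lam ∧ (m : ℂ) = z ∧ (n : ℂ) = starRingEnd ℂ z := by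
  have h_roots := roots_definingCubic_complex hlam hz hz_ne
  exact ⟨⟨lam, roots_subset_fieldE hlam hz hz_ne (by simp [h_roots])⟩,
    ⟨z, roots_subset_fieldE hlam hz hz_ne (by simp [h_roots])⟩,
    ⟨_, roots_subset_fieldE hlam hz hz_ne (by simp [h_roots])⟩, rfl, rfl, rfl⟩

variable {hFE : fieldF ≤ fieldE lam z} {l m n : extendScalars hFE}
  (hl : (l : ℂ) = lam) (hm : (m : ℂ) = z) (hn : (n : ℂ) = starRingEnd ℂ z)
include hl hm hn

theorem roots_definingCubic_extendScalars :
    ((definingCubic fieldF).map (algebraMap fieldF (extendScalars hFE))).roots = {l, m, n} := by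
  have h_roots := roots_definingCubic_complex hlam hz hz_ne
  have h_mem {x : extendScalars hFE} (hx : (x : ℂ) ∈ (definingCubic ℂ).roots) :
      x ∈ (definingCubic (extendScalars hFE)).roots := by
    rw [mem_roots_definingCubic] at hx ⊢
    exact Subtype.ext hx
  have h_ne := (Cubic.discr_ne_zero_iff_roots_ne (P := definingCubic ℂ) (φ := RingHom.id ℂ)
    one_ne_zero (by rw [map_definingCubic, h_roots])).1 (by simp [discr_definingCubic])
  rw [map_definingCubic]
  refine roots_eq_of_ne (h_mem (by simp [h_roots, hl])) (h_mem (by simp [h_roots, hm]))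
    (h_mem (by simp [h_roots, hn])) ?_ ?_ ?_ <;> rintro rfl <;> simp_all

theorem adjoin_root_eq_top : fieldF⟮l⟯ = ⊤ := by
  have h_roots := roots_definingCubic_extendScalars hlam hz hz_ne hl hm hn
  refine toSubfield_injective (subfield_extendScalars_eq_top hFE rfl ?_)
  rintro x (hx | hx)
  · rw [Subtype.ext (hx.trans hl.symm) (a1 := x)]
    exact mem_adjoin_simple_self _ l
  · rw [Subtype.ext (hx.trans hm.symm) (a1 := x)]
    exact mem_adjoin_root_of_isSquare_discr two_ne_zero one_ne_zero h_roots
      isSquare_discr_definingCubic_fieldF discr_definingCubic_fieldF_ne_zero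

theorem exists_basis_pow_root :
    ∃ B : Module.Basis (Fin 3) fieldF (extendScalars hFE), ∀ i, B i = l ^ (i : ℕ) := by
  have h_aeval : Polynomial.aeval l (definingCubic fieldF).toPoly = 0 :=
    (Polynomial.mem_aroots.1 (by
      rw [Polynomial.aroots, ← Cubic.map_roots,
        roots_definingCubic_extendScalars hlam hz hz_ne hl hm hn]
      simp)).2
  refine exists_basis_pow ⟨_, monic_definingCubic, h_aeval⟩
    (adjoin_root_eq_top hlam hz hz_ne hl hm hn) ?_
  rw [← minpoly.eq_of_irreducible_of_monic irreducible_definingCubic_fieldF h_aeval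
    monic_definingCubic]
  exact Cubic.natDegree_of_a_ne_zero (one_ne_zero : (1 : fieldF) ≠ 0)

theorem exists_rotation : ∃ σ : extendScalars hFE ≃ₐ[fieldF] extendScalars hFE,
    σ ^ 3 = 1 ∧ σ l = m ∧ σ m = n ∧ σ n = l :=
  exists_algEquiv_rotating_roots (adjoin_root_eq_top hlam hz hz_ne hl hm hn) two_ne_zero
    irreducible_definingCubic_fieldF one_ne_zero
    (roots_definingCubic_extendScalars hlam hz hz_ne hl hm hn)
    isSquare_discr_definingCubic_fieldF discr_definingCubic_fieldF_ne_zero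

end SplittingField

section Conjugation

open IntermediateField

theorem exists_conj_extendScalars {lam : ℝ} (hlam : lam ^ 3 - lam ^ 2 + 1 = 0) {z : ℂ}
    (hz : z ^ 3 - z ^ 2 + 1 = 0) (hz_ne : z ≠ lam) (hFE : fieldF ≤ fieldE lam z) :
    ∃ τ : extendScalars hFE →+* extendScalars hFE, ∀ x, (τ x : ℂ) = starRingEnd ℂ x :=
  ⟨(starRingEnd ℂ).restrict (extendScalars hFE) (extendScalars hFE)
    fun _ hx => conj_mem_fieldE hlam hz hz_ne hx, fun _ => rfl⟩

variable {lam : ℝ} {z : ℂ} {hFE : fieldF ≤ fieldE lam z}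
  {σ : extendScalars hFE ≃ₐ[fieldF] extendScalars hFE} {τ : extendScalars hFE →+* extendScalars hFE}
  (hτ : ∀ x, (τ x : ℂ) = starRingEnd ℂ x)
include hτ

theorem conj_rotation {l m n : extendScalars hFE} (hl : (l : ℂ) = lam) (hm : (m : ℂ) = z)
    (hn : (n : ℂ) = starRingEnd ℂ z) (hσl : σ l = m) (hσm : σ m = n) (hσn : σ n = l)
    (e : extendScalars hFE) : τ (σ e) = σ (σ (τ e)) := by
  have hτl : τ l = l := Subtype.ext (by rw [hτ, hl, Complex.conj_ofReal])
  have hτm : τ m = n := Subtype.ext (by rw [hτ, hm, hn])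
  have hτn : τ n = m := Subtype.ext (by rw [hτ, hn, hm, Complex.conj_conj])
  have h_top : RingHom.eqLocusField (τ.comp (σ : extendScalars hFE →+* extendScalars hFE))
      ((σ : extendScalars hFE →+* extendScalars hFE).comp
        ((σ : extendScalars hFE →+* extendScalars hFE).comp τ)) = ⊤ := by
    refine subfield_extendScalars_eq_top hFE rfl ?_
    rintro x (hx | hx)
    · rw [Subtype.ext (hx.trans hl.symm) (a1 := x)]
      change τ (σ l) = σ (σ (τ l))
      rw [hσl, hτm, hτl, hσl, hσm]
    · rw [Subtype.ext (hx.trans hm.symm) (a1 := x)]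
      change τ (σ m) = σ (σ (τ m))
      rw [hσm, hτn, hτm, hσn, hσl]
  exact (h_top ▸ Subfield.mem_top e : e ∈ RingHom.eqLocusField _ _)

theorem mem_range_of_conj_eq_of_mem_range {e : extendScalars hFE}
    (he : e ∈ (algebraMap fieldF (extendScalars hFE)).range) (h_conj : τ e = e) :
    e ∈ (algebraMap ℚ (extendScalars hFE)).range := by
  obtain ⟨y, rfl⟩ := he
  obtain ⟨q, hq⟩ := mem_range_of_mem_fieldF_of_conj_eq y.2
    ((hτ _).symm.trans (congrArg Subtype.val h_conj))
  exact ⟨q, Subtype.ext hq.symm⟩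

theorem exists_conj_algebraMap_ne : ∃ δ : fieldF,
    τ (algebraMap fieldF _ δ) ≠ algebraMap fieldF _ δ ∧
      τ (algebraMap fieldF _ δ) ∈ (algebraMap fieldF (extendScalars hFE)).range := by
  refine ⟨⟨_, sqrt_mul_I_mem_fieldF⟩, fun h => ?_, -⟨_, sqrt_mul_I_mem_fieldF⟩, Subtype.ext ?_⟩
  · have h_conj := (hτ _).symm.trans (congrArg Subtype.val h)
    simpa using Complex.conj_eq_iff_im.1 h_conj
  · rw [hτ]
    exact (by simp : -(((Real.sqrt 23 : ℝ) : ℂ) * Complex.I) =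
      starRingEnd ℂ (((Real.sqrt 23 : ℝ) : ℂ) * Complex.I))

end Conjugation

section Involution

open IntermediateField

variable {lam : ℝ} (hlam : lam ^ 3 - lam ^ 2 + 1 = 0) {z : ℂ} (hz : z ^ 3 - z ^ 2 + 1 = 0)
  (hz_ne : z ≠ lam) {hFE : fieldF ≤ fieldE lam z}
  {σ : extendScalars hFE ≃ₐ[fieldF] extendScalars hFE} {hσ : σ ^ 3 = 1}
  {l m n : extendScalars hFE} (hl : (l : ℂ) = lam) (hm : (m : ℂ) = z)
  (hn : (n : ℂ) = starRingEnd ℂ z) (hσl : σ l = m) (hσm : σ m = n) (hσn : σ n = l)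

include hlam hz hz_ne hl hm hn hσl hσm hσn in
theorem exists_isPositiveAntiInvolution_isOfSecondKind
    [FiniteDimensional fieldF (extendScalars hFE)]
    (h_fix : ∀ e, σ e = e → e ∈ (algebraMap fieldF (extendScalars hFE)).range)
    (h_unit : ∀ x : CubicCyclicAlgebra σ hσ (3 : fieldF), x ≠ 0 → IsUnit x) :
    ∃ φ : CubicCyclicAlgebra σ hσ (3 : fieldF) →ₗ[ℚ] CubicCyclicAlgebra σ hσ (3 : fieldF),
      IsPositiveAntiInvolution φ ∧ IsOfSecondKind φ := by
  have := finiteDimensional_fieldF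
  have : FiniteDimensional ℚ (extendScalars hFE) := .trans ℚ fieldF _
  obtain ⟨τ, hτ⟩ := exists_conj_extendScalars hlam hz hz_ne hFE
  obtain ⟨δ, hδ_ne, hδ⟩ := exists_conj_algebraMap_ne hτ
  have h_lt := six_mul_norm_one_sub_root_pow_lt hlam hz hz_ne
  let p : extendScalars hFE := (1 - l) ^ 4
  have hp : (p : ℂ) = ((1 - lam : ℝ) ^ 4 : ℝ) := by simp [p, hl]
  have hσp : (σ p : ℂ) = (1 - z) ^ 4 := by simp [p, hσl, hm]
  have hp_ne : p ≠ 0 := fun h => by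
    have h_zero : (1 - lam) ^ 4 = 0 :=
      Complex.ofReal_eq_zero.1 (hp.symm.trans (congrArg Subtype.val h))
    exact (h_lt.trans_eq h_zero).not_ge (by positivity)
  obtain ⟨t, ht⟩ := h_unit ⟨p, σ (σ p), σ p⟩ fun h => hp_ne (congrArg CubicCyclicAlgebra.c0 h)
  refine ⟨twist (CubicCyclicAlgebra.antiExtension τ) t, ?_,
    CubicCyclicAlgebra.isOfSecondKind_twist_antiExtension hδ_ne hδ t⟩
  refine CubicCyclicAlgebra.isPositiveAntiInvolution_twist (j := algebraMap _ ℂ) (U := 3) (p := p)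
    hτ (conj_rotation hτ hl hm hn hσl hσm hσn)
    (fun e h => mem_range_of_conj_eq_of_mem_range hτ (h_fix e h)) ?_ (by norm_num)
    (Subtype.ext ?_) ?_ t ht
  · rw [map_ofNat, map_ofNat, Complex.ofReal_ofNat]
  · rw [hτ, hp, Complex.conj_ofReal]
  · change 2 * 3 * ‖(σ p : ℂ)‖ < (p : ℂ).re
    rw [hσp, hp, Complex.ofReal_re]
    linarith

end Involution

theorem theorem6p7 (lam : ℝ) (hlam : lam ^ 3 - lam ^ 2 + 1 = 0)
    (z : ℂ) (hz : z ^ 3 - z ^ 2 + 1 = 0) (hz_ne : z ≠ (lam : ℂ)) :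
    ∃ hFE : fieldF ≤ fieldE lam z,
    ∃ σ : IntermediateField.extendScalars hFE ≃ₐ[fieldF] IntermediateField.extendScalars hFE,
    ∃ hσ : σ ^ 3 = 1,
      (∃ a b c : IntermediateField.extendScalars hFE,
        (a : ℂ) = (lam : ℂ) ∧ (b : ℂ) = z ∧ (c : ℂ) = (starRingEnd ℂ) z ∧
          σ a = b ∧ σ b = c ∧ σ c = a) ∧
      (∀ x : CubicCyclicAlgebra σ hσ (3 : fieldF), x ≠ 0 → IsUnit x) ∧
      Algebra.IsCentral fieldF (CubicCyclicAlgebra σ hσ (3 : fieldF)) ∧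
      Module.finrank fieldF (CubicCyclicAlgebra σ hσ (3 : fieldF)) = 9 ∧
      ∃ φ : CubicCyclicAlgebra σ hσ (3 : fieldF) →ₗ[ℚ] CubicCyclicAlgebra σ hσ (3 : fieldF),
        IsPositiveAntiInvolution φ ∧ IsOfSecondKind φ := by
  have hFE := fieldF_le_fieldE hlam hz hz_ne
  obtain ⟨l, m, n, hl, hm, hn⟩ := exists_roots_extendScalars hlam hz hz_ne hFE
  obtain ⟨B, hB⟩ := exists_basis_pow_root hlam hz hz_ne hl hm hn
  have := Module.Basis.finiteDimensional_of_finite B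
  have h_finrank : Module.finrank fieldF (IntermediateField.extendScalars hFE) = 3 := by
    rw [Module.finrank_eq_card_basis B, Fintype.card_fin]
  obtain ⟨σ, hσ, hσl, hσm, hσn⟩ := exists_rotation hlam hz hz_ne hl hm hn
  have hσ_ne : σ ≠ 1 := by
    rintro rfl
    exact hz_ne (hm.symm.trans ((congrArg Subtype.val hσl).symm.trans hl))
  obtain ⟨v, hv_three, hv_norm⟩ := exists_valuation_fieldF
  have h_unit (x : CubicCyclicAlgebra σ hσ (3 : fieldF)) (hx : x ≠ 0) : IsUnit x :=
    CubicCyclicAlgebra.isUnit_of_valuation_cubicNormForm B hB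
      (Subtype.ext (by simpa [hl] using mod_cast hlam)) v hv_three hv_norm hx
  refine ⟨hFE, σ, hσ, ⟨l, m, n, hl, hm, hn, hσl, hσm, hσn⟩, h_unit,
    CubicCyclicAlgebra.isCentral hσ_ne h_finrank,
    by rw [CubicCyclicAlgebra.finrank_eq, h_finrank],
    exists_isPositiveAntiInvolution_isOfSecondKind hlam hz hz_ne hl hm hn hσl hσm hσn
      (fun e => mem_range_algebraMap_of_orderOf_eq_finrank ?_) h_unit⟩
  rw [orderOf_eq_prime hσ hσ_ne, h_finrank]
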